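/- Let $R$ be a commutative noetherian local ring with maximal ideal $\mathfrak m$ and residue field $k=R/\mathfrak m$, and assume $\mathfrak m^3=0\ne\mathfrak m^2$. Put $e=\operatorname{rank}_k\mathfrak m/\mathfrak m^2$, $\operatorname{Soc}R=(0:\mathfrak m)$ and $r=\operatorname{rank}_k(0:\mathfrak m)$, and for a finitely generated $R$-module $M$ let $\beta_i^R(M)=\operatorname{rank}_k\operatorname{Ext}^i_R(M,k)$ be its $i$th Betti number. Assume $\operatorname{Soc}R=\mathfrak m^2$ and $e\ge r+1$. Let $M$ be a non-zero finitely generated $R$-module with $\mathfrak m^2M=0$. Then there exist an integer $n\ge 0$ and $m\in\{n,n+1,n+2,\dots\}\cup\{\infty\}$ such that $$\cdots>\beta_{m+1}^R(M)>\beta_m^R(M)=\cdots=\beta_n^R(M)<\beta_{n-1}^R(M)<\cdots<\beta_0^R(M),$$ that is: - $\beta_{i+1}^R(M)<\beta_i^R(M)$ for all $0\le i<n$; - $\beta_i^R(M)=\beta_n^R(M)$ for all integers $i$ with $n\le i\le m$; - $\beta_{i+1}^R(M)>\beta_i^R(M)$ for all integers $i\ge m$ (no condition if $m=\infty$). Moreover,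 if $e>r+1$, then these $n$ and $m$ satisfy $m=n$ or $m=n+1$. -/

import Mathlib

universe u

open CategoryTheory IsLocalRing

namespace BettiLocal

noncomputable section

/-- The embedding dimension `e = rank_k 𝔪/𝔪²` of a local ring. -/
def embDim (R : Type u) [CommRing R] [IsLocalRing R] : ℕ :=
  Module.finrank (ResidueField R) (CotangentSpace R)

/-- The socle `(0 : 𝔪) = {x ∈ R | a x = 0 for all a ∈ 𝔪}` of a local ring. -/
abbrev socle (R : Type u) [CommRing R] [IsLocalRing R] : Ideal R :=
  Submodule.torsionBySet R R (maximalIdeal R : Set R)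

/-- The natural `k`-vector space structure on the socle, induced by its `R`-module structure. -/
instance socleModule (R : Type u) [CommRing R] [IsLocalRing R] :
    Module (ResidueField R) (socle R) :=
  inferInstanceAs (Module (R ⧸ maximalIdeal R) (socle R))

/-- The socle dimension `r = rank_k (0 : 𝔪)` of a local ring. -/
def socleDim (R : Type u) [CommRing R] [IsLocalRing R] : ℕ :=
  Module.finrank (ResidueField R) (socle R)

/-- The `R`-module `Ext^i_R(M, k)`, where `k` is the residue field of `R`. -/
abbrev ExtResidue (R : Type u) [CommRing R] [IsLocalRing R]
    (M : Type u) [AddCommGroup M] [Module R M] (i : ℕ) : Type u :=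
  Abelian.Ext.{u} (ModuleCat.of R M) (ModuleCat.of R (ResidueField R)) i

/-- The maximal ideal annihilates `Ext^i_R(M, k)`. -/
theorem extResidue_isTorsionBySet (R : Type u) [CommRing R] [IsLocalRing R]
    (M : Type u) [AddCommGroup M] [Module R M] (i : ℕ) :
    Module.IsTorsionBySet R (ExtResidue R M i) (maximalIdeal R : Set R) := by
  intro x a
  have h : (a : R) • 𝟙 (ModuleCat.of R (ResidueField R)) = 0 := by
    ext y
    change (a : R) • y = 0
    rw [Algebra.smul_def]
    have : algebraMap R (ResidueField R) (a : R) = 0 :=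
      (residue_eq_zero_iff (a : R)).2 a.2
    rw [this, zero_mul]
  rw [Abelian.Ext.smul_eq_comp_mk₀, h, Abelian.Ext.mk₀_zero, Abelian.Ext.comp_zero]

/-- The natural `k`-vector space structure on `Ext^i_R(M, k)`, induced by its
`R`-module structure. -/
instance extResidueModule (R : Type u) [CommRing R] [IsLocalRing R]
    (M : Type u) [AddCommGroup M] [Module R M] (i : ℕ) :
    Module (ResidueField R) (ExtResidue R M i) :=
  (extResidue_isTorsionBySet R M i).module

/-- The `i`-th Betti number `β_i^R(M) = rank_k Ext^i_R(M, k)`. -/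
def betti (R : Type u) [CommRing R] [IsLocalRing R]
    (M : Type u) [AddCommGroup M] [Module R M] (i : ℕ) : ℕ :=
  Module.finrank (ResidueField R) (ExtResidue R M i)

end

end BettiLocal

/-! Everything follows from `e * β (i + 1) ≤ β (i + 2) + r * β i`, that is, β_{i+2} - β_{i+1} ≥
r(β_{i+1} - β_i) + (e - r - 1)β_{i+1}. Since r > 0 and e ≥ r + 1, weak or strict growth persists
once it occurs; if e > r + 1 and the Betti numbers are positive, weak growth becomes strict one step
later. The inequality comes from counting lengths along two successive minimal covers
(`isMinimalCover_rank_le`), and `betti_succ` shifts it to every degree. -/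

namespace BettiLocal

open Module

/-! ### Minimal free covers and lengths of syzygies -/

section Covers

variable {R : Type u} [CommRing R]

theorem pi_eq_smul_top (b : ℕ) (I : Ideal R) :
    Submodule.pi Set.univ (fun _ : Fin b => I) = I • (⊤ : Submodule R (Fin b → R)) := by
  apply le_antisymm
  · intro x hx
    rw [pi_eq_sum_univ' x]
    refine Submodule.sum_mem _ fun i _ => Submodule.smul_mem_smul ?_ trivial
    exact hx i trivial
  · refine Submodule.smul_le.2 fun r hr x _ i _ => ?_
    exact I.mul_mem_right _ hr

theorem length_pi_ideal (b : ℕ) (I : Ideal R) :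
    Module.length R (Submodule.pi Set.univ (fun _ : Fin b => I)) = b * Module.length R I := by
  let φ : Submodule.pi Set.univ (fun _ : Fin b => I) ≃ₗ[R] (Fin b → I) :=
    { toFun := fun x i => ⟨x.1 i, x.2 i trivial⟩
      invFun := fun y => ⟨fun i => y i, fun i _ => (y i).2⟩
      map_add' := fun _ _ => rfl
      map_smul' := fun _ _ => rfl
      left_inv := fun _ => rfl
      right_inv := fun _ => rfl }
  rw [φ.length_eq, Module.length_pi]
  simp

variable [IsLocalRing R]

/-- A presentation map `Rᵇ → M` is a minimal free cover if it is onto and its kernel lies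
in `𝔪 Rᵇ`. -/
structure IsMinimalCover {M : Type*} [AddCommGroup M] [Module R M] {b : ℕ}
    (f : (Fin b → R) →ₗ[R] M) : Prop where
  surjective : Function.Surjective f
  ker_le : LinearMap.ker f ≤ Submodule.pi Set.univ (fun _ => maximalIdeal R)

/-- Lift a basis of `k ⊗ M`: Nakayama gives surjectivity, linear independence puts the kernel in
𝔪Rᵇ. -/
theorem exists_isMinimalCover (M : Type*) [AddCommGroup M] [Module R M] [Module.Finite R M] :
    ∃ (b : ℕ) (f : (Fin b → R) →ₗ[R] M), IsMinimalCover f := by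
  let B := Module.finBasis (ResidueField R) (TensorProduct R (ResidueField R) M)
  choose v hv using fun i => TensorProduct.mk_surjective R M (ResidueField R)
    Ideal.Quotient.mk_surjective (B i)
  refine ⟨_, Fintype.linearCombination R v, ?_, ?_⟩
  · rw [← LinearMap.range_eq_top, Fintype.range_linearCombination]
    exact span_eq_top_of_tmul_eq_basis v B hv
  · intro x hx i _
    have h0 : ∑ i, x i • v i = 0 := hx
    have h1 : ∑ i, residue R (x i) • B i = 0 := by
      have := congrArg (TensorProduct.mk R (ResidueField R) M 1) h0
      rw [map_sum, map_zero] at this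
      rw [← this]
      refine Finset.sum_congr rfl fun j _ => ?_
      rw [map_smul, hv j]
      exact (algebraMap_smul (ResidueField R) (x j) (B j))
    exact (residue_eq_zero_iff _).1
      (Fintype.linearIndependent_iff.1 B.linearIndependent _ h1 i)

variable {M : Type*} [AddCommGroup M] [Module R M] {b : ℕ} {f : (Fin b → R) →ₗ[R] M}

theorem IsMinimalCover.map_pi (hf : IsMinimalCover f) (I : Ideal R) :
    (Submodule.pi Set.univ (fun _ : Fin b => I)).map f = I • ⊤ := by
  rw [pi_eq_smul_top, Submodule.map_smul'', Submodule.map_top,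
    LinearMap.range_eq_top.2 hf.surjective]

theorem length_pi_quotient (b : ℕ) :
    Module.length R ((Fin b → R) ⧸ Submodule.pi Set.univ (fun _ : Fin b => maximalIdeal R))
      = b := by
  rw [(Submodule.quotientPi (fun _ : Fin b => maximalIdeal R)).length_eq, Module.length_pi]
  have : IsSimpleModule R (R ⧸ maximalIdeal R) :=
    isSimpleModule_iff_isCoatom.2 (maximalIdeal.isMaximal R).out
  rw [Module.length_eq_one]
  simp

theorem IsMinimalCover.length_le (hf : IsMinimalCover f) :
    Module.length R M ≤ Module.length R (maximalIdeal R • ⊤ : Submodule R M) + b := by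
  set L : Submodule R M := maximalIdeal R • ⊤
  rw [Module.length_eq_add_of_exact L.subtype L.mkQ L.subtype_injective L.mkQ_surjective
    (LinearMap.exact_subtype_mkQ L), ← length_pi_quotient (R := R) b]
  gcongr
  let P := Submodule.pi Set.univ (fun _ : Fin b => maximalIdeal R)
  have h : P ≤ L.comap f := Submodule.map_le_iff_le_comap.1 (hf.map_pi _).le
  refine Module.length_le_of_surjective (P.mapQ L f h) ?_
  rw [← LinearMap.range_eq_top, Submodule.range_mapQ, LinearMap.range_eq_top.2 hf.surjective,
    Submodule.map_top, Submodule.range_mkQ]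

theorem IsMinimalCover.pos [Nontrivial M] (hf : IsMinimalCover f) : 0 < b := by
  rcases Nat.eq_zero_or_pos b with rfl | h
  · have := hf.surjective.subsingleton
    exact absurd this (not_subsingleton M)
  · exact h

theorem IsMinimalCover.pi_le_ker (hf : IsMinimalCover f) {I : Ideal R}
    (hI : I • (⊤ : Submodule R M) = ⊥) :
    Submodule.pi Set.univ (fun _ : Fin b => I) ≤ LinearMap.ker f := by
  rw [LinearMap.le_ker_iff_map, hf.map_pi, hI]

theorem IsMinimalCover.nontrivial_ker [Nontrivial M] (hf : IsMinimalCover f) {I : Ideal R}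
    (hI0 : I ≠ ⊥) (hI : I • (⊤ : Submodule R M) = ⊥) : Nontrivial (LinearMap.ker f) := by
  obtain ⟨a, ha, ha0⟩ := Submodule.exists_mem_ne_zero_of_ne_bot hI0
  refine ⟨⟨⟨fun _ => a, hf.pi_le_ker hI fun _ _ => ha⟩, 0, fun h => ha0 ?_⟩⟩
  exact congrFun (congrArg Subtype.val h) ⟨0, hf.pos⟩

theorem IsMinimalCover.smul_ker_le (hf : IsMinimalCover f) (n : ℕ) :
    (maximalIdeal R ^ n • (⊤ : Submodule R (LinearMap.ker f))).map (LinearMap.ker f).subtype ≤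
      Submodule.pi Set.univ (fun _ => maximalIdeal R ^ (n + 1)) := by
  rw [Submodule.map_smul'', Submodule.map_top, Submodule.range_subtype]
  refine Submodule.smul_le.2 fun r hr x hx i _ => ?_
  exact Ideal.mul_mem_mul hr (hf.ker_le hx i trivial)

theorem IsMinimalCover.sq_smul_ker (hf : IsMinimalCover f) (hm3 : maximalIdeal R ^ 3 = ⊥) :
    maximalIdeal R ^ 2 • (⊤ : Submodule R (LinearMap.ker f)) = ⊥ := by
  rw [eq_bot_iff]
  intro x hx
  refine Subtype.ext (funext fun i => ?_)
  have : x.1 i ∈ maximalIdeal R ^ 3 :=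
    hf.smul_ker_le 2 (Submodule.mem_map_of_mem hx) i trivial
  rwa [hm3] at this

theorem IsMinimalCover.length_smul_ker_le (hf : IsMinimalCover f) :
    Module.length R (maximalIdeal R • ⊤ : Submodule R (LinearMap.ker f)) ≤
      b * Module.length R (maximalIdeal R ^ 2 : Ideal R) := by
  rw [← length_pi_ideal]
  have h := hf.smul_ker_le 1
  rw [pow_one] at h
  refine Module.length_le_of_injective
    ((LinearMap.ker f).subtype.restrict (Submodule.map_le_iff_le_comap.1 h)) fun x y hxy => ?_
  have h' := Subtype.ext_iff.1 hxy
  exact Subtype.ext (Subtype.ext h')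

/-- By minimality, 0 → ker f → 𝔪Rᵇ → 𝔪M → 0 is exact. -/
theorem IsMinimalCover.length_pi_eq (hf : IsMinimalCover f) :
    b * Module.length R (maximalIdeal R) =
      Module.length R (LinearMap.ker f) +
        Module.length R (maximalIdeal R • ⊤ : Submodule R M) := by
  rw [← length_pi_ideal]
  have h := hf.map_pi (maximalIdeal R)
  refine Module.length_eq_add_of_exact (Submodule.inclusion hf.ker_le)
    (f.restrict (Submodule.map_le_iff_le_comap.1 h.le)) (Submodule.inclusion_injective _) ?_ ?_
  · rintro ⟨y, hy⟩
    obtain ⟨x, hx, rfl⟩ := h.ge hy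
    exact ⟨⟨x, hx⟩, rfl⟩
  · intro x
    constructor
    · intro hx
      exact ⟨⟨x.1, congrArg Subtype.val hx⟩, rfl⟩
    · rintro ⟨y, rfl⟩
      exact Subtype.ext y.2

end Covers

/-! ### Numerical invariants and Betti numbers from covers -/

section Ranks

variable {R : Type u} [CommRing R] [IsLocalRing R]

theorem length_socle [IsNoetherianRing R] :
    Module.length R (socle R) = socleDim R := by
  have : IsScalarTower R (ResidueField R) (socle R) :=
    inferInstanceAs (IsScalarTower R (R ⧸ maximalIdeal R) (socle R))
  have : Module.Finite (ResidueField R) (socle R) :=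
    Module.Finite.of_restrictScalars_finite R _ _
  rw [Module.length_eq_of_surjective (R := ResidueField R) (residue_surjective (R := R)),
    Module.length_eq_finrank, socleDim]

theorem length_maximalIdeal [IsNoetherianRing R] :
    Module.length R (maximalIdeal R) =
      Module.length R (maximalIdeal R ^ 2 : Ideal R) + embDim R := by
  have hc : Module.length R (CotangentSpace R) = embDim R := by
    rw [Module.length_eq_of_surjective (R := ResidueField R) (residue_surjective (R := R)),
      Module.length_eq_finrank, embDim]
  rw [← hc]
  refine Module.length_eq_add_of_exact
    (Submodule.inclusion (Ideal.pow_le_self two_ne_zero)) (maximalIdeal R).toCotangent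
    (Submodule.inclusion_injective _) (maximalIdeal R).toCotangent_surjective ?_
  intro x
  rw [Ideal.toCotangent_eq_zero]
  constructor
  · exact fun hx => ⟨⟨x.1, hx⟩, rfl⟩
  · rintro ⟨y, rfl⟩
    exact y.2

/-- For the syzygies N = ker f₀ and K = ker f₁, b₁(r + e) = ℓ(K) + ℓ(𝔪N), where ℓ(K) ≤ ℓ(𝔪K) + b₂,
ℓ(𝔪K) ≤ b₁r and ℓ(𝔪N) ≤ b₀r. Cancel b₁r. -/
theorem isMinimalCover_rank_le [IsNoetherianRing R] (hsoc : socle R = maximalIdeal R ^ 2)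
    {M : Type*} [AddCommGroup M] [Module R M] {b₀ b₁ b₂ : ℕ}
    {f₀ : (Fin b₀ → R) →ₗ[R] M} (h₀ : IsMinimalCover f₀)
    {f₁ : (Fin b₁ → R) →ₗ[R] LinearMap.ker f₀} (h₁ : IsMinimalCover f₁)
    {f₂ : (Fin b₂ → R) →ₗ[R] LinearMap.ker f₁} (h₂ : IsMinimalCover f₂) :
    embDim R * b₁ ≤ b₂ + socleDim R * b₀ := by
  have hr : Module.length R (maximalIdeal R ^ 2 : Ideal R) = socleDim R := by
    rw [← hsoc, length_socle]
  have key := h₁.length_pi_eq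
  rw [length_maximalIdeal, hr] at key
  have l₀ := h₀.length_smul_ker_le
  have l₁ := h₁.length_smul_ker_le
  rw [hr] at l₀ l₁
  have l₂ := h₂.length_le
  have : (b₁ : ℕ∞) * (socleDim R + embDim R) ≤
      (b₁ * socleDim R + b₂) + b₀ * socleDim R :=
    key.trans_le (add_le_add (l₂.trans (add_le_add_left l₁ _)) l₀)
  norm_cast at this
  linarith

theorem finrank_eq_of_linearEquiv {V W : Type*} [AddCommGroup V] [AddCommGroup W]
    [Module R V] [Module R W] [Module (ResidueField R) V] [Module (ResidueField R) W]
    [IsScalarTower R (ResidueField R) V] [IsScalarTower R (ResidueField R) W]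
    (φ : V ≃ₗ[R] W) :
    Module.finrank (ResidueField R) V = Module.finrank (ResidueField R) W :=
  (φ.extendScalarsOfSurjective (residue_surjective (R := R))).finrank_eq

instance (M : Type u) [AddCommGroup M] [Module R M] (i : ℕ) :
    IsScalarTower R (ResidueField R) (ExtResidue R M i) :=
  (extResidue_isTorsionBySet R M i).isScalarTower

variable {M : Type u} [AddCommGroup M] [Module R M] {b : ℕ} {f : (Fin b → R) →ₗ[R] M}

theorem pi_le_ker_residueField (g : (Fin b → R) →ₗ[R] ResidueField R) :
    Submodule.pi Set.univ (fun _ : Fin b => maximalIdeal R) ≤ LinearMap.ker g := by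
  rw [pi_eq_smul_top]
  refine Submodule.smul_le.2 fun r hr x _ => ?_
  rw [LinearMap.mem_ker, map_smul, Algebra.smul_def]
  have : algebraMap R (ResidueField R) r = 0 := (residue_eq_zero_iff r).2 hr
  rw [this, zero_mul]

/-- Any map Rᵇ → k kills 𝔪Rᵇ, hence ker f, so it factors through M. -/
theorem IsMinimalCover.lcomp_bijective (hf : IsMinimalCover f) :
    Function.Bijective (LinearMap.lcomp R (ResidueField R) f) := by
  constructor
  · intro g h hgh
    exact LinearMap.cancel_right hf.surjective |>.1 hgh
  · intro g
    have hk : LinearMap.ker f ≤ LinearMap.ker g := hf.ker_le.trans (pi_le_ker_residueField g)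
    refine ⟨(LinearMap.ker f).liftQ g hk ∘ₗ
      (f.quotKerEquivOfSurjective hf.surjective).symm.toLinearMap, ?_⟩
    ext1 i
    ext
    simp [LinearMap.lcomp_apply]

theorem IsMinimalCover.betti_zero (hf : IsMinimalCover f) : betti R M 0 = b := by
  let φ : ExtResidue R M 0 ≃ₗ[R] (Fin b → ResidueField R) :=
    Abelian.Ext.linearEquiv₀ ≪≫ₗ ModuleCat.homLinearEquiv ≪≫ₗ
      LinearEquiv.ofBijective _ hf.lcomp_bijective ≪≫ₗ
      ((Pi.basisFun R (Fin b)).constr R).symm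
  rw [betti, finrank_eq_of_linearEquiv φ, Module.finrank_fin_fun]

theorem IsMinimalCover.betti_succ (hf : IsMinimalCover f) (i : ℕ) :
    betti R M (i + 1) = betti R (LinearMap.ker f) i := by
  let S := f.shortComplexKer
  have hS : S.ShortExact := LinearMap.shortExact_shortComplexKer hf.surjective
  have : Projective S.X₂ := (IsProjective.iff_projective (P := Fin b → R)).1 inferInstance
  let δ : ExtResidue R (LinearMap.ker f) i →ₗ[R] ExtResidue R M (i + 1) :=
    Abelian.Ext.precompOfLinear hS.extClass R _ (add_comm 1 i)
  have hδ : Function.Bijective δ := by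
    constructor
    · rw [injective_iff_map_eq_zero]
      intro x hx
      -- The kernel of `δ` comes from Ext(Rᵇ, k) by restriction to ker f. That restriction is zero:
      -- by minimality in degree 0, by projectivity above.
      obtain ⟨y, rfl⟩ := Abelian.Ext.contravariant_sequence_exact₁ hS _ x (add_comm 1 i) hx
      cases i with
      | zero =>
        obtain ⟨g, rfl⟩ := Abelian.Ext.addEquiv₀.symm.surjective y
        have hg : S.f ≫ g = 0 := by
          ext x
          exact pi_le_ker_residueField g.hom (hf.ker_le x.2)
        change (Abelian.Ext.mk₀ S.f).comp (Abelian.Ext.mk₀ g) _ = 0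
        rw [Abelian.Ext.mk₀_comp_mk₀, hg, Abelian.Ext.mk₀_zero]
      | succ i => rw [Abelian.Ext.eq_zero_of_projective y, Abelian.Ext.comp_zero]
    · exact precomp_extClass_surjective_of_projective_X₂ _ hS i
  rw [betti, betti, finrank_eq_of_linearEquiv (LinearEquiv.ofBijective δ hδ)]

end Ranks

/-! ### Positivity and the recurrence in all degrees -/

section Growth

variable (R : Type u) [CommRing R] [IsNoetherianRing R] [IsLocalRing R]

/-- The condition 𝔪²M = 0 passes to syzygies because 𝔪³ = 0, and it makes the syzygy contain 𝔪²Rᵇ ≠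
0. -/
theorem betti_pos (hm3 : maximalIdeal R ^ 3 = ⊥) (hm2 : maximalIdeal R ^ 2 ≠ ⊥) (i : ℕ) :
    ∀ (M : Type u) [AddCommGroup M] [Module R M] [Module.Finite R M] [Nontrivial M],
      maximalIdeal R ^ 2 • (⊤ : Submodule R M) = ⊥ → 0 < betti R M i := by
  induction i with
  | zero =>
    intro M _ _ _ _ hM
    obtain ⟨b, f, hf⟩ := exists_isMinimalCover (R := R) M
    rw [hf.betti_zero]
    exact hf.pos
  | succ i ih =>
    intro M _ _ _ _ hM
    obtain ⟨b, f, hf⟩ := exists_isMinimalCover (R := R) M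
    have := hf.nontrivial_ker hm2 hM
    rw [hf.betti_succ]
    exact ih _ (hf.sq_smul_ker hm3)

theorem embDim_mul_betti_le (hsoc : socle R = maximalIdeal R ^ 2) (i : ℕ) :
    ∀ (M : Type u) [AddCommGroup M] [Module R M] [Module.Finite R M],
      embDim R * betti R M (i + 1) ≤ betti R M (i + 2) + socleDim R * betti R M i := by
  induction i with
  | zero =>
    intro M _ _ _
    obtain ⟨b₀, f₀, h₀⟩ := exists_isMinimalCover (R := R) M
    obtain ⟨b₁, f₁, h₁⟩ := exists_isMinimalCover (R := R) (LinearMap.ker f₀)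
    obtain ⟨b₂, f₂, h₂⟩ := exists_isMinimalCover (R := R) (LinearMap.ker f₁)
    rw [h₀.betti_succ, h₀.betti_succ, h₁.betti_succ, h₀.betti_zero, h₁.betti_zero,
      h₂.betti_zero]
    exact isMinimalCover_rank_le hsoc h₀ h₁ h₂
  | succ i ih =>
    intro M _ _ _
    obtain ⟨b, f, hf⟩ := exists_isMinimalCover (R := R) M
    rw [hf.betti_succ, hf.betti_succ, hf.betti_succ]
    exact ih _

end Growth

theorem socleDim_pos {R : Type u} [CommRing R] [IsNoetherianRing R] [IsLocalRing R]
    (h : socle R ≠ ⊥) : 0 < socleDim R := by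
  have : Nontrivial (socle R) := Submodule.nontrivial_iff_ne_bot.2 h
  have h := Module.length_pos (R := R) (M := socle R)
  rw [length_socle] at h
  exact_mod_cast h

/-- A sequence of positive integers with `e βᵢ₊₁ ≤ βᵢ₊₂ + r βᵢ`, where `e > r > 0`, first
decreases strictly, then is constant, and then increases strictly. -/
theorem exists_decreasing_constant_increasing {β : ℕ → ℕ} {e r : ℕ} (hr : 0 < r)
    (her : r + 1 ≤ e) (hpos : ∀ i, 0 < β i)
    (hβ : ∀ i, e * β (i + 1) ≤ β (i + 2) + r * β i) :
    ∃ (n : ℕ) (m : ℕ∞), (n : ℕ∞) ≤ m ∧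
      (∀ i : ℕ, i < n → β (i + 1) < β i) ∧
      (∀ i : ℕ, n ≤ i → (i : ℕ∞) ≤ m → β i = β n) ∧
      (∀ i : ℕ, m ≤ (i : ℕ∞) → β i < β (i + 1)) ∧
      (r + 1 < e → m = (n : ℕ∞) ∨ m = (n : ℕ∞) + 1) := by
  classical
  have hex : ∃ n, β n ≤ β (n + 1) := by
    by_contra! h
    exact not_strictAnti_of_wellFoundedLT β (strictAnti_nat_of_succ_lt h)
  have hle : ∀ i, β i ≤ β (i + 1) → β (i + 1) ≤ β (i + 2) := fun i hi => by
    have h1 := Nat.mul_le_mul_right (β (i + 1)) her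
    have h2 := Nat.mul_le_mul_left r hi
    have h3 := hβ i
    linarith
  have hlt : ∀ i, β i < β (i + 1) → β (i + 1) < β (i + 2) := fun i hi => by
    have h1 := Nat.mul_le_mul_right (β (i + 1)) her
    have h2 := Nat.mul_lt_mul_of_pos_left hi hr
    have h3 := hβ i
    linarith
  have hlt' : r + 1 < e → ∀ i, β i ≤ β (i + 1) → β (i + 1) < β (i + 2) := fun he i hi => by
    have h1 := Nat.mul_lt_mul_of_pos_right he (hpos (i + 1))
    have h2 := Nat.mul_le_mul_left r hi
    have h3 := hβ i
    linarith
  obtain ⟨n, hn, hmin⟩ : ∃ n, β n ≤ β (n + 1) ∧ ∀ i < n, β (i + 1) < β i :=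
    ⟨Nat.find hex, Nat.find_spec hex, fun i hi => not_le.1 (Nat.find_min hex hi)⟩
  have hmono : ∀ i, n ≤ i → β i ≤ β (i + 1) := fun i hi => by
    induction i, hi using Nat.le_induction with
    | base => exact hn
    | succ i _ ih => exact hle i ih
  by_cases hinc : ∃ m, n ≤ m ∧ β m < β (m + 1)
  · obtain ⟨m, ⟨hnm, hm⟩, hmmin⟩ : ∃ m, (n ≤ m ∧ β m < β (m + 1)) ∧
        ∀ i < m, ¬ (n ≤ i ∧ β i < β (i + 1)) :=
      ⟨Nat.find hinc, Nat.find_spec hinc, fun i hi => Nat.find_min hinc hi⟩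
    refine ⟨n, m, by exact_mod_cast hnm, hmin, fun i hi him => ?_, fun i hi => ?_, fun he => ?_⟩
    · have him : i ≤ m := by exact_mod_cast him
      induction i, hi using Nat.le_induction with
      | base => rfl
      | succ i hi ih =>
        rw [← ih (by exact_mod_cast Nat.le_of_lt him) (Nat.le_of_lt him)]
        have := hmmin i him
        have := hmono i hi
        grind
    · replace hi : m ≤ i := by exact_mod_cast hi
      induction i, hi using Nat.le_induction with
      | base => exact hm
      | succ i hi ih => exact hlt i ih
    -- Weak growth at n forces strict growth at n + 1, so m, the first strict increase from n on, is
    -- at most n + 1.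
    · have h1 : ¬ n + 1 < m := fun h => hmmin _ h ⟨n.le_succ, hlt' he n hn⟩
      have : m = n ∨ m = n + 1 := by omega
      exact_mod_cast this
  · push Not at hinc
    refine ⟨n, ⊤, le_top, hmin, fun i hi _ => ?_, fun i hi => ?_, fun he => ?_⟩
    · induction i, hi using Nat.le_induction with
      | base => rfl
      | succ i hi ih => exact (le_antisymm (hinc i hi) (hmono i hi)).trans (ih le_top)
    · exact absurd hi (by simp)
    · exact absurd (hlt' he n hn) (not_lt.2 (hinc (n + 1) n.le_succ))

end BettiLocal

theorem mainTheorem6 (R : Type u) [CommRing R] [IsNoetherianRing R] [IsLocalRing R]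
    (hm3 : maximalIdeal R ^ 3 = ⊥) (hm2 : maximalIdeal R ^ 2 ≠ ⊥)
    (hsoc : BettiLocal.socle R = maximalIdeal R ^ 2)
    (her : BettiLocal.socleDim R + 1 ≤ BettiLocal.embDim R)
    (M : Type u) [AddCommGroup M] [Module R M] [Module.Finite R M] [Nontrivial M]
    (hM : maximalIdeal R ^ 2 • (⊤ : Submodule R M) = ⊥) :
    ∃ (n : ℕ) (m : ℕ∞), (n : ℕ∞) ≤ m ∧
      (∀ i : ℕ, i < n → BettiLocal.betti R M (i + 1) < BettiLocal.betti R M i) ∧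
      (∀ i : ℕ, n ≤ i → (i : ℕ∞) ≤ m → BettiLocal.betti R M i = BettiLocal.betti R M n) ∧
      (∀ i : ℕ, m ≤ (i : ℕ∞) → BettiLocal.betti R M i < BettiLocal.betti R M (i + 1)) ∧
      (BettiLocal.socleDim R + 1 < BettiLocal.embDim R →
        m = (n : ℕ∞) ∨ m = (n : ℕ∞) + 1) :=
  BettiLocal.exists_decreasing_constant_increasing
    (BettiLocal.socleDim_pos (hsoc.symm ▸ hm2)) her
    (fun i => BettiLocal.betti_pos R hm3 hm2 i M hM)
    (fun i => BettiLocal.embDim_mul_betti_le R hsoc i M)
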